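/- Let $(d_l,d_r,d_g)\in\{(2,3,3),(3,4,3)\}$ and put $R_{\mathrm{pre}}=1-\frac{d_l}{d_r}$. For $\beta>0$ let $\Lambda(x)=e^{-\beta(1-x)}$, $R_{\mathrm{total}}(\beta)=\frac{d_g}{\beta}R_{\mathrm{pre}}$, $\epsilon^{\mathrm{Sha}}(\beta)=1-R_{\mathrm{total}}(\beta)$, and let $$\nu(x;\epsilon)=\frac{d_g}{\beta}x_1^{d_l}\Lambda(x_2),\qquad \mu(x;\epsilon)=\frac{d_gd_l}{\beta d_r}x_1^{d_r}+\epsilon x_2^{d_g}$$ be the degree distribution of the $(d_l,d_r,d_g)$ precoded-rateless code (an outer $(d_l,d_r)$-regular LDPC code; each transmitted symbol is the sum of $d_g$ uniformly chosen outer-code bits; $\beta$ is the mean number of received-channel factor nodes per bit). Write $\nu_j,\mu_j$ for partial derivatives in $x_j$ and let $f,g$ be the maps of density evolution (DE) under belief-propagation (BP) decoding on BEC($\epsilon$), $$[g(x;\epsilon)]_j=1-\frac{\mu_j(\mathbf 1-x;1-\epsilon)}{\mu_j(\mathbf 1;1)},\qquad [f(y;\epsilon)]_j=\frac{\nu_j(y;\epsilon)}{\nu_j(\mathbf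 1;1)}\qquad(j=1,2).$$ The potential is $$U(x;\epsilon)=\mu(\mathbf 1;1-\epsilon)-\mu(\mathbf 1-x;1-\epsilon)-\nu(g(x;\epsilon);\epsilon)-\sum_{j=1}^2x_j\,\mu_j(\mathbf 1-x;1-\epsilon).$$ Let $\mathcal F(\epsilon)$ be the set of nonzero $x\in[0,1]^2$ with $x=f(g(x;\epsilon);\epsilon)$, and let the potential threshold be $\epsilon^*=\sup\{\epsilon\in[0,1]:\inf_{x\in\mathcal F(\epsilon)}U(x;\epsilon)>0\}$. The DE of the spatially-coupled code with coupling number $L$ and coupling width $w$, for erasure probabilities $(\epsilon_i)_{i\in\mathbb Z}$ of the sections, is $x_i^{(0)}=\mathbf 1$ and $$x_i^{(t+1)}=\frac1w\sum_{\substack{0\le k\le w-1\\ 0\le i-k\le L-1}} f\Big(\frac1w\sum_{j=0}^{w-1}g\big(x^{(t)}_{i+j-k};\epsilon_{i+j-k}\big);\epsilon_{i-k}\Big)\qquad(i\in\mathbb Z),$$ that is, the bits in sections outside $\{0,\dots,L-1\}$ are known to the decoder. Say that the coupled DE converges to $0$ at $\epsilon$ if $x_i^{(t)}\to 0$ as $t\to\infty$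 for all $i$ and for every choice of $\epsilon_i\in[0,\epsilon]$ (in particular for $\epsilon_i=\epsilon$ for all $i$, and for $\epsilon_i=\epsilon$ on $\{0,\dots,L-1\}$ and $0$ elsewhere). The design rate of the coupled code is $$R(\beta,w,L)=\frac{L-\frac{d_l}{d_r}(L+w-1)}{\frac{\beta}{d_g}(L+w-1)}.$$ Theorem. (A) For every $\beta>d_gR_{\mathrm{pre}}$ (equivalently $0<R_{\mathrm{total}}(\beta)<1$): 1. the set defining $\epsilon^*$ is nonempty and $\epsilon^*=\epsilon^{\mathrm{Sha}}(\beta)$; 2. for every $\epsilon$ with $0\le\epsilon<\epsilon^{\mathrm{Sha}}(\beta)$ there is $w_0$ such that for all $w\ge w_0$ and all $L$ the coupled DE converges to $0$ at $\epsilon$; 3. for every fixed $w\ge1$, $R(\beta,w,L)\to R_{\mathrm{total}}(\beta)$ as $L\to\infty$. (B) Consequently the spatially-coupled codes achieve the capacity of the BEC under BP decoding, in the sense of density evolution: for every $\epsilon\in[0,1)$ and every $R<1-\epsilon$ there are $\beta>d_gR_{\mathrm{pre}}$ and $w_0$ such that for every $w\ge w_0$ there is $L_0$ such that, for all $L\ge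 L_0$, $R(\beta,w,L)>R$ and the coupled DE converges to $0$ at $\epsilon$. -/

import Mathlib

open Filter Topology

noncomputable section

namespace PrecodedRateless

/-! ### Density evolution of a code with a multivariate degree distribution `(ν, μ)` -/

section General

variable {d : ℕ}

/-- The partial derivative `∂h/∂x_j (x; ε)` of a function `h(x; ε)`, `x ∈ ℝ^d`. -/
def pderiv (h : (Fin d → ℝ) → ℝ → ℝ) (j : Fin d) (x : Fin d → ℝ) (ε : ℝ) : ℝ :=
  deriv (fun s => h (Function.update x j s) ε) (x j)

/-- `[g(x; ε)]_j = 1 - μ_j(1 - x; 1 - ε) / μ_j(1; 1)`. -/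
def deG (μ : (Fin d → ℝ) → ℝ → ℝ) (x : Fin d → ℝ) (ε : ℝ) : Fin d → ℝ :=
  fun j => 1 - pderiv μ j (1 - x) (1 - ε) / pderiv μ j 1 1

/-- `[f(y; ε)]_j = ν_j(y; ε) / ν_j(1; 1)`. -/
def deF (ν : (Fin d → ℝ) → ℝ → ℝ) (y : Fin d → ℝ) (ε : ℝ) : Fin d → ℝ :=
  fun j => pderiv ν j y ε / pderiv ν j 1 1

/-- The potential function `U(x; ε)` of the density-evolution system of `(ν, μ)`. -/
def potential (ν μ : (Fin d → ℝ) → ℝ → ℝ) (x : Fin d → ℝ) (ε : ℝ) : ℝ :=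
  μ 1 (1 - ε) - μ (1 - x) (1 - ε) - ν (deG μ x ε) ε
    - ∑ j, x j * pderiv μ j (1 - x) (1 - ε)

/-- The nonzero fixed points in `[0,1]^d` of the uncoupled recursion `x ↦ f(g(x; ε); ε)`. -/
def fixedPoints (ν μ : (Fin d → ℝ) → ℝ → ℝ) (ε : ℝ) : Set (Fin d → ℝ) :=
  {x | (∀ j, x j ∈ Set.Icc (0 : ℝ) 1) ∧ x ≠ 0 ∧ deF ν (deG μ x ε) ε = x}

/-- The parameters `ε ∈ [0,1]` at which the infimum of the potential over the nonzero fixed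
points is positive. -/
def positiveGapSet (ν μ : (Fin d → ℝ) → ℝ → ℝ) : Set ℝ :=
  {ε | ε ∈ Set.Icc (0 : ℝ) 1 ∧ 0 < sInf ((fun x => potential ν μ x ε) '' fixedPoints ν μ ε)}

/-- The potential threshold. -/
def potentialThreshold (ν μ : (Fin d → ℝ) → ℝ → ℝ) : ℝ :=
  sSup (positiveGapSet ν μ)

/-- Density evolution of the spatially coupled system with coupling number `L` and coupling
width `w`; `e i` is the channel erasure probability at section `i`. The bit sections are
`0, …, L - 1`; the bits at every other section are known to the decoder, so that they
contribute `0` in place of the value of `f`. -/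
def coupledDE (ν μ : (Fin d → ℝ) → ℝ → ℝ) (w L : ℕ) (e : ℤ → ℝ) : ℕ → ℤ → Fin d → ℝ
  | 0, _ => 1
  | t + 1, i => (w : ℝ)⁻¹ • ∑ k ∈ Finset.range w,
      if 0 ≤ i - (k : ℤ) ∧ i - (k : ℤ) < (L : ℤ) then
        deF ν ((w : ℝ)⁻¹ • ∑ j ∈ Finset.range w,
          deG μ (coupledDE ν μ w L e t (i + j - k)) (e (i + j - k))) (e (i - k))
      else 0

/-- Coupled density evolution converges to `0` at every section, for every assignment to the
sections of erasure probabilities that are at most `ε`. This covers the constant profile `ε` and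
the profile equal to `ε` on sections `0, …, L - 1` and to `0` on the others. -/
def CoupledDEConverges (ν μ : (Fin d → ℝ) → ℝ → ℝ) (w L : ℕ) (ε : ℝ) : Prop :=
  ∀ e : ℤ → ℝ, (∀ i, e i ∈ Set.Icc (0 : ℝ) ε) →
    ∀ i : ℤ, Tendsto (fun t : ℕ => coupledDE ν μ w L e t i) atTop (𝓝 0)

end General

/-! ### The `(dl, dr, dg)` precoded-rateless code -/

/-- `Λ(x) = exp (-β (1 - x))`, the Poisson generating function. -/
def Lam (β x : ℝ) : ℝ := Real.exp (-β * (1 - x))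

/-- `R_pre = 1 - dl / dr`. -/
def preRate (dl dr : ℕ) : ℝ := 1 - (dl : ℝ) / dr

/-- `R_total = (dg / β) (1 - dl / dr)`. -/
def totalRate (dl dr dg : ℕ) (β : ℝ) : ℝ := (dg : ℝ) / β * preRate dl dr

/-- The Shannon limit `1 - R_total`. -/
def shannonLimit (dl dr dg : ℕ) (β : ℝ) : ℝ := 1 - totalRate dl dr dg β

/-- `ν(x; ε) = (dg / β) x₁ ^ dl Λ(x₂)`. -/
def nu (dl dg : ℕ) (β : ℝ) (x : Fin 2 → ℝ) (_ε : ℝ) : ℝ :=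
  (dg : ℝ) / β * x 0 ^ dl * Lam β (x 1)

/-- `μ(x; ε) = (dg dl / (β dr)) x₁ ^ dr + ε x₂ ^ dg`. -/
def mu (dl dr dg : ℕ) (β : ℝ) (x : Fin 2 → ℝ) (ε : ℝ) : ℝ :=
  (dg : ℝ) * dl / (β * dr) * x 0 ^ dr + ε * x 1 ^ dg

/-- The design rate of the spatially coupled code. Per `M` bits of a section, there are `L` bit
sections, `dl / dr` parity checks at each of `L + w - 1` sections, and `β / dg` channel symbols at
each of `L + w - 1` sections. -/
def coupledRate (dl dr dg : ℕ) (β : ℝ) (w L : ℕ) : ℝ :=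
  ((L : ℝ) - (dl : ℝ) / dr * ((L : ℝ) + w - 1)) / (β / dg * ((L : ℝ) + w - 1))

end PrecodedRateless

end

/-!
Coupled density evolution is monotone in the profile, in the erasure probabilities and in the set of
unknown sections, so every coupled chain is dominated by the semi-infinite chain with bit sections
`0, 1, 2, …` and constant parameter `ε`. Started from `1`, density evolution on that chain decreases
in time and increases along the chain. Its limit `p` is a fixed profile that vanishes at negative
sections and tends, far from the boundary, to a fixed point `q` of the uncoupled recursion.

Let `D` be the diagonal matrix of the edge weights, `G` the primitive of `D g`, and `ν` that of
`D f`; the potential is `U(x) = ⟨D x, g x⟩ - G x - ν (g x)`. Write `⟨D q, g q⟩` as a telescoping sum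
along the chain and apply the product rule to its differences. One part is a right-end-point sum for
`G`, which exceeds `G q` by `O(1 / w)` because the increments of `p` are at most `1 / w`. In the
other part, summation by parts moves the averaging window from the bit side to the check side and
produces a left-end-point sum for `ν`, which is at most `ν (g q)` because `ν` is convex along
increasing segments. Hence `U(q) ≤ K d / w` (`energy_le`). If `U` has a positive lower bound on the
nonzero fixed points, then `q = 0` for large `w`, and `p ≤ q` forces `p = 0`
(`tendsto_oneSidedDE_zero`, `exists_coupledDEConverges`).

For the potential itself, `U(1; ε)` is the Shannon limit minus `ε`, so `ε` can have a positive gap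
only below the Shannon limit. Conversely, at a nonzero fixed point put `x = x₁`, `z = x₂` and
`c = β (1 - ε)`. The exponential can be eliminated, `z` is a polynomial in `x`, and
`β U = A(x) + c z² (3 - 2 z)` for a polynomial `A`. Being below the Shannon limit means
`c > dg (1 - dl / dr)`, and replacing `c` by this bound leaves a polynomial inequality in `x`. It
holds on `[0, 1]` for the `(3, 4, 3)` code, and on `[1/5, 1]` for the `(2, 3, 3)` code, where
the fixed-point equation excludes `0 < x < 1/5` (`fixedPoints_potential_pos`). As the nonzero fixed
points stay away from `0`, compactness gives the uniform lower bound.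
-/

namespace PrecodedRateless

/-! ### Density evolution on a semi-infinite chain -/

section OneSided

variable {d : ℕ}

/-- The average of the check-side messages at the sections `m, …, m + w - 1`, to which bit section `m`
is connected. -/
noncomputable def windowAvg (g : (Fin d → ℝ) → Fin d → ℝ) (w : ℕ) (x : ℤ → Fin d → ℝ) (m : ℤ) :
    Fin d → ℝ :=
  (w : ℝ)⁻¹ • ∑ j ∈ Finset.range w, g (x (m + j))

/-- The messages sent by bit section `m` of the semi-infinite chain whose bit sections are
`0, 1, 2, …`; the bits at negative sections are known. -/
noncomputable def bitMsg (f g : (Fin d → ℝ) → Fin d → ℝ) (w : ℕ) (x : ℤ → Fin d → ℝ) (m : ℤ) :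
    Fin d → ℝ :=
  if 0 ≤ m then f (windowAvg g w x m) else 0

/-- One step of density evolution on the semi-infinite chain. -/
noncomputable def oneSidedStep (f g : (Fin d → ℝ) → Fin d → ℝ) (w : ℕ) (x : ℤ → Fin d → ℝ) (i : ℤ) :
    Fin d → ℝ :=
  (w : ℝ)⁻¹ • ∑ k ∈ Finset.range w, bitMsg f g w x (i - k)

/-- Density evolution on the semi-infinite chain, started from the all-one profile. -/
noncomputable def oneSidedDE (f g : (Fin d → ℝ) → Fin d → ℝ) (w : ℕ) : ℕ → ℤ → Fin d → ℝ
  | 0 => fun _ => 1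
  | t + 1 => oneSidedStep f g w (oneSidedDE f g w t)

/-- A monotone continuous self-map of the unit cube. -/
structure IsCubeMap (f : (Fin d → ℝ) → Fin d → ℝ) : Prop where
  mono : MonotoneOn f (Set.Icc 0 1)
  maps : Set.MapsTo f (Set.Icc 0 1) (Set.Icc 0 1)
  cont : Continuous f

lemma avg_mono (w : ℕ) {a b : ℕ → Fin d → ℝ} (h : ∀ k, a k ≤ b k) :
    (w : ℝ)⁻¹ • ∑ k ∈ Finset.range w, a k ≤ (w : ℝ)⁻¹ • ∑ k ∈ Finset.range w, b k :=
  smul_le_smul_of_nonneg_left (Finset.sum_le_sum fun k _ => h k) (by positivity)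

lemma avg_const {w : ℕ} (hw : 1 ≤ w) (a : Fin d → ℝ) :
    (w : ℝ)⁻¹ • ∑ _k ∈ Finset.range w, a = a := by
  have : (w : ℝ) ≠ 0 := by positivity
  rw [Finset.sum_const, Finset.card_range, ← Nat.cast_smul_eq_nsmul ℝ, smul_smul,
    inv_mul_cancel₀ this, one_smul]

lemma avg_mem (w : ℕ) {a : ℕ → Fin d → ℝ} (h : ∀ k, a k ∈ Set.Icc 0 1) :
    (w : ℝ)⁻¹ • ∑ k ∈ Finset.range w, a k ∈ Set.Icc 0 1 := by
  constructor
  · simpa using avg_mono (d := d) w (a := fun _ => 0) fun k => (h k).1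
  · rcases Nat.eq_zero_or_pos w with rfl | hw
    · simp
    · simpa only [avg_const (d := d) hw] using avg_mono (d := d) w (b := fun _ => 1) fun k => (h k).2

variable {f g : (Fin d → ℝ) → Fin d → ℝ} {w : ℕ}

lemma windowAvg_mem (hg : IsCubeMap g) {x : ℤ → Fin d → ℝ} (hx : ∀ i, x i ∈ Set.Icc 0 1) (m : ℤ) :
    windowAvg g w x m ∈ Set.Icc 0 1 :=
  avg_mem w fun _ => hg.maps (hx _)

lemma bitMsg_mem (hf : IsCubeMap f) (hg : IsCubeMap g) {x : ℤ → Fin d → ℝ}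
    (hx : ∀ i, x i ∈ Set.Icc 0 1) (m : ℤ) : bitMsg f g w x m ∈ Set.Icc 0 1 := by
  unfold bitMsg
  split_ifs
  · exact hf.maps (windowAvg_mem hg hx m)
  · simp

lemma oneSidedStep_mem (hf : IsCubeMap f) (hg : IsCubeMap g) {x : ℤ → Fin d → ℝ}
    (hx : ∀ i, x i ∈ Set.Icc 0 1) (i : ℤ) : oneSidedStep f g w x i ∈ Set.Icc 0 1 :=
  avg_mem w fun _ => bitMsg_mem hf hg hx _

/-- Monotonicity of one step in the profile and in the position together: a profile `x` that lies
below the translate of `x'` by `s ≥ 0` sections is mapped below the translate of the image. -/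
lemma oneSidedStep_mono (hf : IsCubeMap f) (hg : IsCubeMap g) {x x' : ℤ → Fin d → ℝ}
    (hx : ∀ i, x i ∈ Set.Icc 0 1) (hx' : ∀ i, x' i ∈ Set.Icc 0 1) {s : ℤ} (hs : 0 ≤ s)
    (h : ∀ i, x i ≤ x' (i + s)) (i : ℤ) :
    oneSidedStep f g w x i ≤ oneSidedStep f g w x' (i + s) := by
  refine avg_mono w fun k => ?_
  have e : i + s - k = i - k + s := by ring
  rw [e]
  by_cases h0 : 0 ≤ i - (k : ℤ)
  · rw [bitMsg, bitMsg, if_pos h0, if_pos (by omega)]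
    refine hf.mono (windowAvg_mem hg hx _) (windowAvg_mem hg hx' _) (avg_mono w fun j => ?_)
    refine hg.mono (hx _) (hx' _) ((h _).trans_eq ?_)
    congr 1
    ring
  · rw [bitMsg, if_neg h0]
    exact (bitMsg_mem hf hg hx' _).1

lemma oneSidedDE_mem (hf : IsCubeMap f) (hg : IsCubeMap g) (t : ℕ) (i : ℤ) :
    oneSidedDE f g w t i ∈ Set.Icc 0 1 := by
  induction t generalizing i with
  | zero => simp [oneSidedDE]
  | succ t ih => exact oneSidedStep_mem hf hg ih i

lemma oneSidedDE_antitone (hf : IsCubeMap f) (hg : IsCubeMap g) (i : ℤ) :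
    Antitone fun t => oneSidedDE f g w t i := by
  refine antitone_nat_of_succ_le fun t => ?_
  induction t generalizing i with
  | zero => exact (oneSidedDE_mem hf hg 1 i).2
  | succ t ih =>
    have := oneSidedStep_mono (w := w) hf hg (oneSidedDE_mem hf hg (t + 1))
      (oneSidedDE_mem hf hg t) le_rfl (fun i => by simpa only [add_zero] using ih i) i
    rw [add_zero] at this
    exact this

lemma oneSidedDE_monotone (hf : IsCubeMap f) (hg : IsCubeMap g) (t : ℕ) :
    Monotone (oneSidedDE f g w t) := by
  refine monotone_int_of_le_succ fun i => ?_
  induction t generalizing i with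
  | zero => exact le_rfl
  | succ t ih =>
    exact oneSidedStep_mono hf hg (oneSidedDE_mem hf hg t) (oneSidedDE_mem hf hg t) zero_le_one ih i

lemma oneSidedStep_of_neg (x : ℤ → Fin d → ℝ) {i : ℤ} (hi : i < 0) :
    oneSidedStep f g w x i = 0 := by
  have (k : ℕ) : bitMsg f g w x (i - k) = 0 := if_neg (by omega)
  simp [oneSidedStep, this]

lemma continuous_oneSidedStep (hf : Continuous f) (hg : Continuous g) :
    Continuous (oneSidedStep f g w) := by
  refine continuous_pi fun i => ?_
  have (k : ℕ) : Continuous fun x => bitMsg f g w x (i - k) := ?_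
  · exact (continuous_finsetSum (Finset.range w) fun k _ => this k).const_smul (w : ℝ)⁻¹
  unfold bitMsg
  split_ifs
  · unfold windowAvg
    fun_prop
  · exact continuous_const

/-- The limit of density evolution on the semi-infinite chain: a fixed profile that increases along
the chain. -/
lemma exists_tendsto_oneSidedDE (hf : IsCubeMap f) (hg : IsCubeMap g) (w : ℕ) :
    ∃ p : ℤ → Fin d → ℝ, (∀ i, Tendsto (fun t => oneSidedDE f g w t i) atTop (𝓝 (p i))) ∧
      (∀ i, p i ∈ Set.Icc 0 1) ∧ Monotone p ∧ oneSidedStep f g w p = p := by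
  have hlim (i : ℤ) := tendsto_atTop_ciInf (oneSidedDE_antitone (w := w) hf hg i)
    ⟨0, by rintro _ ⟨t, rfl⟩; exact (oneSidedDE_mem hf hg t i).1⟩
  refine ⟨_, hlim, fun i => ?_, fun i j hij => ?_, ?_⟩
  · exact isClosed_Icc.mem_of_tendsto (hlim i) (.of_forall fun t => oneSidedDE_mem hf hg t i)
  · exact le_of_tendsto_of_tendsto' (hlim i) (hlim j) fun t => oneSidedDE_monotone hf hg t hij
  · have h1 := tendsto_pi_nhds.2 hlim
    have h2 := ((continuous_oneSidedStep (w := w) hf.cont hg.cont).tendsto _).comp h1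
    exact tendsto_nhds_unique h2 (h1.comp (tendsto_add_atTop_nat 1))

/-- Far from the boundary, a monotone fixed profile of the semi-infinite chain approaches a fixed
point of the uncoupled recursion. -/
lemma exists_tendsto_right (hf : IsCubeMap f) (hg : IsCubeMap g) (hw : 1 ≤ w)
    {p : ℤ → Fin d → ℝ} (hp : ∀ i, p i ∈ Set.Icc 0 1) (hmono : Monotone p)
    (hfix : oneSidedStep f g w p = p) :
    ∃ q, Tendsto p atTop (𝓝 q) ∧ q ∈ Set.Icc 0 1 ∧ (∀ i, p i ≤ q) ∧ f (g q) = q ∧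
      Tendsto (windowAvg g w p) atTop (𝓝 (g q)) := by
  have hlim := tendsto_atTop_ciSup hmono ⟨1, by rintro _ ⟨t, rfl⟩; exact (hp t).2⟩
  set q := ⨆ i, p i
  have hz : Tendsto (windowAvg g w p) atTop (𝓝 (g q)) := by
    rw [← avg_const hw (g q)]
    have (j : ℕ) : Tendsto (fun m : ℤ => g (p (m + j))) atTop (𝓝 (g q)) :=
      (hg.cont.tendsto q).comp (hlim.comp (tendsto_atTop_add_const_right _ (j : ℤ) tendsto_id))
    exact (tendsto_finsetSum (Finset.range w) fun j _ => this j).const_smul (w : ℝ)⁻¹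
  have hv : Tendsto (bitMsg f g w p) atTop (𝓝 (f (g q))) := by
    refine ((hf.cont.tendsto _).comp hz).congr' ?_
    filter_upwards [eventually_ge_atTop 0] with m hm
    simp [bitMsg, hm]
  have hstep : Tendsto (oneSidedStep f g w p) atTop (𝓝 (f (g q))) := by
    rw [← avg_const hw (f (g q))]
    have (k : ℕ) : Tendsto (fun i : ℤ => bitMsg f g w p (i - k)) atTop (𝓝 (f (g q))) :=
      hv.comp (tendsto_atTop_add_const_right _ (-(k : ℤ)) tendsto_id)
    exact (tendsto_finsetSum (Finset.range w) fun k _ => this k).const_smul (w : ℝ)⁻¹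
  refine ⟨q, hlim, isClosed_Icc.mem_of_tendsto hlim (.of_forall hp),
    fun i => hmono.ge_of_tendsto hlim i, ?_, hz⟩
  rw [hfix] at hstep
  exact tendsto_nhds_unique hstep hlim

/-! ### The energy estimate -/

/-- Shifting a window of a nonnegative sequence that vanishes at negative indices to the left. -/
lemma sum_range_shift_le {h : ℤ → ℝ} (h0 : ∀ m, 0 ≤ h m) (hneg : ∀ m < 0, h m = 0) (N k : ℕ) :
    ∑ i ∈ Finset.range (N + 1), h (i - 1 - k) ≤ ∑ m ∈ Finset.range N, h m := by
  induction k with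
  | zero =>
    rw [Finset.sum_range_succ']
    simp [hneg (-1) (by norm_num)]
  | succ k ih =>
    refine le_trans ?_ ih
    rw [Finset.sum_range_succ', Finset.sum_range_succ, hneg _ (by push_cast; omega)]
    refine add_le_add (Finset.sum_le_sum fun i _ => le_of_eq ?_) (h0 _)
    congr 1
    push_cast
    ring

/-- Summation by parts moves the averaging window from the bit side to the check side. The
inequality comes from the part of the windows that lies beyond section `N`. -/
lemma sum_window_swap_le (w N : ℕ) {a y : ℤ → ℝ} (ha : ∀ m, 0 ≤ a m) (hneg : ∀ m < 0, a m = 0)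
    (hy : Monotone y) :
    ∑ i ∈ Finset.range (N + 1), (∑ k ∈ Finset.range w, a (i - 1 - k)) * (y i - y (i - 1)) ≤
      ∑ m ∈ Finset.range N, a m * ∑ k ∈ Finset.range w, (y (m + 1 + k) - y (m + k)) := by
  simp_rw [Finset.sum_mul, Finset.mul_sum]
  rw [Finset.sum_comm, Finset.sum_comm (s := Finset.range N)]
  refine Finset.sum_le_sum fun k _ => ?_
  have := sum_range_shift_le (h := fun m => a m * (y (m + 1 + k) - y (m + k)))
    (fun m => mul_nonneg (ha m) (sub_nonneg.2 (hy (by omega))))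
    (fun m hm => by simp [hneg m hm]) N k
  refine (le_of_eq (Finset.sum_congr rfl fun i _ => ?_)).trans this
  rw [show (i : ℤ) - 1 - k + 1 + k = i by ring, show (i : ℤ) - 1 - k + k = i - 1 by ring]

/-- The increments of a profile after one step are at most `1 / w`, as the windows of adjacent
sections differ in one section at each end. -/
lemma oneSidedStep_sub_le (hf : IsCubeMap f) (hg : IsCubeMap g) {x : ℤ → Fin d → ℝ}
    (hx : ∀ i, x i ∈ Set.Icc 0 1) (i : ℤ) (j : Fin d) :
    oneSidedStep f g w x i j - oneSidedStep f g w x (i - 1) j ≤ (w : ℝ)⁻¹ := by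
  have key : oneSidedStep f g w x i j - oneSidedStep f g w x (i - 1) j =
      (w : ℝ)⁻¹ * (bitMsg f g w x i j - bitMsg f g w x (i - w) j) := by
    have := Finset.sum_range_sub' (fun k : ℕ => bitMsg f g w x (i - k) j) w
    simp only [oneSidedStep, Pi.smul_apply, Finset.sum_apply, smul_eq_mul, ← mul_sub,
      ← Finset.sum_sub_distrib]
    rw [Nat.cast_zero, sub_zero] at this
    rw [← this]
    congr 1
    refine Finset.sum_congr rfl fun k _ => ?_
    rw [Nat.cast_add, Nat.cast_one, sub_sub, add_comm (1 : ℤ)]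
  rw [key]
  have h1 : bitMsg f g w x i j ≤ 1 := (bitMsg_mem hf hg hx i).2 j
  have h2 : 0 ≤ bitMsg f g w x (i - w) j := (bitMsg_mem hf hg hx (i - w)).1 j
  exact mul_le_of_le_one_right (by positivity) (by linarith)

/-- The energy estimate. Let `F` and `G` be potentials of `D • f` and `D • g`, in the sense that
sums of `f` at left end points are at most differences of `F` and that sums of `g` at right end
points exceed differences of `G` at most by second-order terms. Then a fixed profile that increases
along the semi-infinite chain has almost nonpositive energy `⟨D p, g p⟩ - G p - F`. -/
lemma energy_le (hf : IsCubeMap f) (hg : IsCubeMap g) {D : Fin d → ℝ} (hD : 0 ≤ D)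
    {F G : (Fin d → ℝ) → ℝ} {K : ℝ} (hK : 0 ≤ K)
    (hF0 : ∀ z ∈ Set.Icc 0 1, 0 ≤ F z) (hG0 : G 0 = 0)
    (hF : ∀ z ∈ Set.Icc 0 1, ∀ z' ∈ Set.Icc 0 1, z ≤ z' →
      ∑ j, D j * (f z j * (z' j - z j)) ≤ F z' - F z)
    (hG : ∀ x ∈ Set.Icc 0 1, ∀ x' ∈ Set.Icc 0 1, x ≤ x' →
      ∑ j, D j * ((x' j - x j) * g x' j) ≤ G x' - G x + K * ∑ j, (x' j - x j) ^ 2)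
    {p : ℤ → Fin d → ℝ} (hp : ∀ i, p i ∈ Set.Icc 0 1) (hmono : Monotone p)
    (hfix : oneSidedStep f g w p = p) (N : ℕ) :
    ∑ j, D j * (p N j * g (p N) j) ≤ G (p N) + F (windowAvg g w p N) + K * d / w := by
  have hneg1 : p (-1) = 0 := by rw [← hfix]; exact oneSidedStep_of_neg p (by norm_num)
  have hgp (j : Fin d) : Monotone fun i => g (p i) j :=
    fun i i' h => hg.mono (hp i) (hp i') (hmono h) j
  -- the product rule for differences
  have hprod : ∑ j, D j * (p N j * g (p N) j) =
      ∑ i ∈ Finset.range (N + 1), ∑ j, D j * ((p i j - p (i - 1) j) * g (p i) j) +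
      ∑ i ∈ Finset.range (N + 1), ∑ j, D j * (p (i - 1) j * (g (p i) j - g (p (i - 1)) j)) := by
    have := Finset.sum_range_sub
      (fun n : ℕ => ∑ j, D j * (p ((n : ℤ) - 1) j * g (p ((n : ℤ) - 1)) j)) (N + 1)
    simp only [Nat.cast_add, Nat.cast_one, add_sub_cancel_right, Nat.cast_zero, zero_sub, hneg1,
      Pi.zero_apply, zero_mul, mul_zero, Finset.sum_const_zero, sub_zero] at this
    rw [← this, ← Finset.sum_add_distrib]
    refine Finset.sum_congr rfl fun i _ => ?_
    rw [← Finset.sum_sub_distrib, ← Finset.sum_add_distrib]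
    refine Finset.sum_congr rfl fun j _ => ?_
    ring
  have hone : ∑ i ∈ Finset.range (N + 1), ∑ j, D j * ((p i j - p (i - 1) j) * g (p i) j) ≤
      G (p N) + K * d / w := by
    have hstep (i : ℤ) : ∑ j, D j * ((p i j - p (i - 1) j) * g (p i) j) ≤
        (G (p i) - G (p (i - 1))) + K * (w : ℝ)⁻¹ * (∑ j, p i j - ∑ j, p (i - 1) j) := by
      refine (hG _ (hp (i - 1)) _ (hp i) (hmono (by omega))).trans ?_
      rw [mul_assoc, ← Finset.sum_sub_distrib, Finset.mul_sum _ _ (w : ℝ)⁻¹]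
      refine add_le_add_right (mul_le_mul_of_nonneg_left (Finset.sum_le_sum fun j _ => ?_) hK) _
      have h1 : p (i - 1) j ≤ p i j := hmono (by omega : i - 1 ≤ i) j
      have h2 := oneSidedStep_sub_le (w := w) hf hg hp i j
      rw [hfix] at h2
      rw [sq]
      exact mul_le_mul_of_nonneg_right h2 (sub_nonneg.2 h1)
    refine (Finset.sum_le_sum fun (i : ℕ) _ => hstep i).trans ?_
    have t1 := Finset.sum_range_sub (fun n : ℕ => G (p ((n : ℤ) - 1))) (N + 1)
    have t2 := Finset.sum_range_sub (fun n : ℕ => ∑ j, p ((n : ℤ) - 1) j) (N + 1)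
    simp only [Nat.cast_add, Nat.cast_one, add_sub_cancel_right, Nat.cast_zero, zero_sub, hneg1,
      Pi.zero_apply, Finset.sum_const_zero, sub_zero, hG0] at t1 t2
    rw [Finset.sum_add_distrib, ← Finset.mul_sum, t1, t2, div_eq_mul_inv, mul_right_comm K]
    have : ∑ j, p N j ≤ d := by
      simpa using Finset.sum_le_sum fun j (_ : j ∈ Finset.univ) => (hp N).2 j
    have hw0 : (0 : ℝ) ≤ (w : ℝ)⁻¹ := by positivity
    have : K * (w : ℝ)⁻¹ * ∑ j, p N j ≤ K * (w : ℝ)⁻¹ * d := by gcongr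
    linarith
  have htwo : ∑ i ∈ Finset.range (N + 1),
      ∑ j, D j * (p (i - 1) j * (g (p i) j - g (p (i - 1)) j)) ≤ F (windowAvg g w p N) := by
    calc _ = ∑ j, D j * ((w : ℝ)⁻¹ * ∑ i ∈ Finset.range (N + 1),
          (∑ k ∈ Finset.range w, bitMsg f g w p (i - 1 - k) j) *
            (g (p i) j - g (p (i - 1)) j)) := by
          rw [Finset.sum_comm]
          refine Finset.sum_congr rfl fun j _ => ?_
          rw [Finset.mul_sum, Finset.mul_sum]
          refine Finset.sum_congr rfl fun i _ => ?_
          have : p (i - 1) j = (w : ℝ)⁻¹ * ∑ k ∈ Finset.range w, bitMsg f g w p (i - 1 - k) j := by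
            conv_lhs => rw [← hfix]
            simp only [oneSidedStep, Pi.smul_apply, Finset.sum_apply, smul_eq_mul]
          rw [this]
          ring
      _ ≤ ∑ j, D j * ((w : ℝ)⁻¹ * ∑ m ∈ Finset.range N, bitMsg f g w p m j *
            ∑ k ∈ Finset.range w, (g (p (m + 1 + k)) j - g (p (m + k)) j)) := by
          gcongr with j
          · exact hD j
          · exact sum_window_swap_le w N (a := fun m => bitMsg f g w p m j)
              (fun m => (bitMsg_mem hf hg hp m).1 j)
              (fun m hm => by simp [bitMsg, not_le.2 hm]) (hgp j)
      _ = ∑ m ∈ Finset.range N, ∑ j, D j * (f (windowAvg g w p m) j *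
            (windowAvg g w p (m + 1) j - windowAvg g w p m j)) := by
          rw [Finset.sum_comm]
          refine Finset.sum_congr rfl fun j _ => ?_
          rw [Finset.mul_sum, Finset.mul_sum]
          refine Finset.sum_congr rfl fun m _ => ?_
          simp only [bitMsg, Nat.cast_nonneg, if_true]
          simp only [windowAvg, Pi.smul_apply, Finset.sum_apply, smul_eq_mul,
            Finset.sum_sub_distrib]
          ring
      _ ≤ ∑ m ∈ Finset.range N, (F (windowAvg g w p (m + 1)) - F (windowAvg g w p m)) := by
          refine Finset.sum_le_sum fun m _ => hF _ (windowAvg_mem hg hp _) _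
            (windowAvg_mem hg hp _) (avg_mono w fun k => ?_)
          exact hg.mono (hp _) (hp _) (hmono (by omega))
      _ ≤ F (windowAvg g w p N) := by
          have := Finset.sum_range_sub (fun n : ℕ => F (windowAvg g w p n)) N
          push_cast at this
          rw [this]
          linarith [hF0 _ (windowAvg_mem (w := w) hg hp 0)]
  linarith

/-- Threshold saturation on the semi-infinite chain: if the potential exceeds `K d / w` at every
nonzero fixed point of the uncoupled recursion, the limit far from the boundary can only be `0`. -/
theorem tendsto_oneSidedDE_zero (hf : IsCubeMap f) (hg : IsCubeMap g) {D : Fin d → ℝ} (hD : 0 ≤ D)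
    {F G : (Fin d → ℝ) → ℝ} {K : ℝ} (hK : 0 ≤ K)
    (hFc : Continuous F) (hGc : Continuous G)
    (hF0 : ∀ z ∈ Set.Icc 0 1, 0 ≤ F z) (hG0 : G 0 = 0)
    (hF : ∀ z ∈ Set.Icc 0 1, ∀ z' ∈ Set.Icc 0 1, z ≤ z' →
      ∑ j, D j * (f z j * (z' j - z j)) ≤ F z' - F z)
    (hG : ∀ x ∈ Set.Icc 0 1, ∀ x' ∈ Set.Icc 0 1, x ≤ x' →
      ∑ j, D j * ((x' j - x j) * g x' j) ≤ G x' - G x + K * ∑ j, (x' j - x j) ^ 2)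
    (hw : 1 ≤ w)
    (hpos : ∀ q ∈ Set.Icc 0 1, q ≠ 0 → f (g q) = q →
      K * d / w < ∑ j, D j * (q j * g q j) - G q - F (g q)) (i : ℤ) :
    Tendsto (fun t => oneSidedDE f g w t i) atTop (𝓝 0) := by
  obtain ⟨p, hlim, hp, hmono, hfix⟩ := exists_tendsto_oneSidedDE hf hg w
  obtain ⟨q, hpq, hq, hle, hqfix, hzq⟩ := exists_tendsto_right hf hg hw hp hmono hfix
  have hcast : Tendsto (fun N : ℕ => (N : ℤ)) atTop atTop := tendsto_natCast_atTop_atTop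
  have hlimit : ∑ j, D j * (q j * g q j) ≤ G q + F (g q) + K * d / w := by
    refine le_of_tendsto_of_tendsto' (f := fun N : ℕ => ∑ j, D j * (p N j * g (p N) j))
      (b := atTop) ?_ ?_ (energy_le hf hg hD hK hF0 hG0 hF hG hp hmono hfix)
    · have hc : Continuous fun x : Fin d → ℝ => ∑ j, D j * (x j * g x j) := by
        have := hg.cont
        fun_prop
      exact (hc.tendsto q).comp (hpq.comp hcast)
    · exact ((hGc.tendsto q).comp (hpq.comp hcast)).add
        ((hFc.tendsto _).comp (hzq.comp hcast)) |>.add_const _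
  have hq0 : q = 0 := by
    by_contra h
    linarith [hpos q hq h hqfix]
  have : p i = 0 := le_antisymm (hq0 ▸ hle i) (hp i).1
  exact this ▸ hlim i

/-- The semi-infinite chain with constant parameter `ε` dominates every coupled chain whose
parameters are at most `ε`. -/
lemma coupledDE_le_oneSidedDE {ν μ : (Fin d → ℝ) → ℝ → ℝ} (hf : IsCubeMap f) (hg : IsCubeMap g)
    {ε : ℝ} (hfν : ∀ y e, deF ν y e = f y)
    (hgμ : ∀ x ∈ Set.Icc 0 1, ∀ e ∈ Set.Icc 0 ε, deG μ x e ∈ Set.Icc 0 (g x))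
    (w L : ℕ) {e : ℤ → ℝ} (he : ∀ i, e i ∈ Set.Icc 0 ε) (t : ℕ) (i : ℤ) :
    coupledDE ν μ w L e t i ∈ Set.Icc 0 (oneSidedDE f g w t i) := by
  induction t generalizing i with
  | zero => simp [coupledDE, oneSidedDE]
  | succ t ih =>
    have hcube (i : ℤ) : coupledDE ν μ w L e t i ∈ Set.Icc 0 1 :=
      ⟨(ih i).1, (ih i).2.trans (oneSidedDE_mem hf hg t i).2⟩
    have hgi (i : ℤ) : deG μ (coupledDE ν μ w L e t i) (e i) ∈
        Set.Icc 0 (g (oneSidedDE f g w t i)) := by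
      have h := hgμ _ (hcube i) (e i) (he i)
      exact ⟨h.1, h.2.trans (hg.mono (hcube i) (oneSidedDE_mem hf hg t i) (ih i).2)⟩
    have hg1 (i : ℤ) : deG μ (coupledDE ν μ w L e t i) (e i) ∈ Set.Icc 0 1 :=
      ⟨(hgi i).1, (hgi i).2.trans (hg.maps (oneSidedDE_mem hf hg t i)).2⟩
    have hbit (k : ℕ) : (if 0 ≤ i - (k : ℤ) ∧ i - (k : ℤ) < (L : ℤ) then
        deF ν ((w : ℝ)⁻¹ • ∑ j ∈ Finset.range w,
          deG μ (coupledDE ν μ w L e t (i + j - k)) (e (i + j - k))) (e (i - k))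
      else 0) ∈ Set.Icc 0 (bitMsg f g w (oneSidedDE f g w t) (i - k)) := by
      split_ifs with h
      · rw [hfν, bitMsg, if_pos h.1]
        have hm := avg_mem w fun j : ℕ => hg1 (i + j - k)
        refine ⟨(hf.maps hm).1, hf.mono hm (windowAvg_mem hg (oneSidedDE_mem hf hg t) _)
          (avg_mono w fun j => ?_)⟩
        rw [sub_add_eq_add_sub]
        exact (hgi _).2
      · exact ⟨le_rfl, (bitMsg_mem hf hg (oneSidedDE_mem hf hg t) _).1⟩
    constructor
    · simpa [coupledDE] using avg_mono w fun k => (hbit k).1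
    · exact avg_mono w fun k => (hbit k).2

end OneSided

/-! ### Density evolution of the precoded-rateless code -/

section Code

variable {dl dr dg : ℕ} {β ε : ℝ}

lemma pderiv_nu_zero (x : Fin 2 → ℝ) (e : ℝ) :
    pderiv (nu dl dg β) 0 x e = dg * dl / β * (x 0 ^ (dl - 1) * Lam β (x 1)) := by
  have h : HasDerivAt (fun s : ℝ => (dg : ℝ) / β * s ^ dl * Lam β (x 1))
      (dg / β * (dl * x 0 ^ (dl - 1)) * Lam β (x 1)) (x 0) :=
    ((hasDerivAt_pow dl (x 0)).const_mul _).mul_const _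
  simp only [pderiv, nu, Function.update_self, ne_eq, one_ne_zero, not_false_eq_true,
    Function.update_of_ne]
  rw [h.deriv]
  ring

lemma pderiv_nu_one (hβ : β ≠ 0) (x : Fin 2 → ℝ) (e : ℝ) :
    pderiv (nu dl dg β) 1 x e = dg * (x 0 ^ dl * Lam β (x 1)) := by
  have h : HasDerivAt (fun s : ℝ => (dg : ℝ) / β * x 0 ^ dl * Lam β s)
      (dg / β * x 0 ^ dl * (Lam β (x 1) * (-β * (-1)))) (x 1) :=
    (((hasDerivAt_id (x 1)).const_sub 1).const_mul (-β)).exp.const_mul _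
  simp only [pderiv, nu, Function.update_self, ne_eq, zero_ne_one, not_false_eq_true,
    Function.update_of_ne]
  rw [h.deriv]
  field_simp

lemma pderiv_mu_zero (hdr : dr ≠ 0) (x : Fin 2 → ℝ) (e : ℝ) :
    pderiv (mu dl dr dg β) 0 x e = dg * dl / β * x 0 ^ (dr - 1) := by
  have h : HasDerivAt (fun s : ℝ => (dg : ℝ) * dl / (β * dr) * s ^ dr + e * x 1 ^ dg)
      (dg * dl / (β * dr) * (dr * x 0 ^ (dr - 1))) (x 0) :=
    ((hasDerivAt_pow dr (x 0)).const_mul _).add_const _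
  simp only [pderiv, mu, Function.update_self, ne_eq, one_ne_zero, not_false_eq_true,
    Function.update_of_ne]
  rw [h.deriv]
  field_simp

lemma pderiv_mu_one (x : Fin 2 → ℝ) (e : ℝ) :
    pderiv (mu dl dr dg β) 1 x e = dg * (e * x 1 ^ (dg - 1)) := by
  have h : HasDerivAt (fun s : ℝ => (dg : ℝ) * dl / (β * dr) * x 0 ^ dr + e * s ^ dg)
      (e * (dg * x 1 ^ (dg - 1))) (x 1) :=
    ((hasDerivAt_pow dg (x 1)).const_mul _).const_add _
  simp only [pderiv, mu, Function.update_self, ne_eq, zero_ne_one, not_false_eq_true,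
    Function.update_of_ne]
  rw [h.deriv]
  ring

/-- The bit-side map `f` of density evolution. -/
noncomputable def bitMap (dl : ℕ) (β : ℝ) (y : Fin 2 → ℝ) : Fin 2 → ℝ :=
  ![y 0 ^ (dl - 1) * Lam β (y 1), y 0 ^ dl * Lam β (y 1)]

/-- The check-side map `g` of density evolution. -/
def checkMap (dr dg : ℕ) (ε : ℝ) (x : Fin 2 → ℝ) : Fin 2 → ℝ :=
  ![1 - (1 - x 0) ^ (dr - 1), 1 - (1 - ε) * (1 - x 1) ^ (dg - 1)]

/-- The weights `μ_j(1; 1) = ν_j(1; 1)`, the mean numbers of edges of the two types. -/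
noncomputable def edgeWeight (dl dg : ℕ) (β : ℝ) : Fin 2 → ℝ := ![dg * dl / β, dg]

/-- The primitive of the check-side map with respect to the edge weights that vanishes at `0`. -/
noncomputable def checkPrimitive (dl dr dg : ℕ) (β ε : ℝ) (x : Fin 2 → ℝ) : ℝ :=
  dg * dl / β * (x 0 - (1 - (1 - x 0) ^ dr) / dr) + (dg * x 1 - (1 - ε) * (1 - (1 - x 1) ^ dg))

lemma deF_nu (hdl : dl ≠ 0) (hdg : dg ≠ 0) (hβ : β ≠ 0) (y : Fin 2 → ℝ) (e : ℝ) :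
    deF (nu dl dg β) y e = bitMap dl β y := by
  funext j
  fin_cases j
  · simp [deF, bitMap, pderiv_nu_zero, Lam]
    field_simp
  · simp [deF, bitMap, pderiv_nu_one hβ, Lam]
    field_simp

lemma deG_mu (hdl : dl ≠ 0) (hdr : dr ≠ 0) (hdg : dg ≠ 0) (hβ : β ≠ 0) (x : Fin 2 → ℝ) (e : ℝ) :
    deG (mu dl dr dg β) x e = checkMap dr dg e x := by
  funext j
  fin_cases j
  · simp [deG, checkMap, pderiv_mu_zero hdr]
    field_simp
  · simp [deG, checkMap, pderiv_mu_one]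
    field_simp

/-- The potential is the Legendre-type expression `⟨D x, g x⟩ - G x - ν (g x)` to which the energy
estimate applies. -/
lemma potential_eq (hdl : dl ≠ 0) (hdr : dr ≠ 0) (hdg : dg ≠ 0) (hβ : β ≠ 0) (x : Fin 2 → ℝ) :
    potential (nu dl dg β) (mu dl dr dg β) x ε =
      ∑ j, edgeWeight dl dg β j * (x j * checkMap dr dg ε x j) - checkPrimitive dl dr dg β ε x
        - nu dl dg β (checkMap dr dg ε x) 0 := by
  rw [potential, deG_mu hdl hdr hdg hβ]
  simp only [Fin.sum_univ_two, pderiv_mu_zero hdr, pderiv_mu_one, edgeWeight, checkPrimitive, nu,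
    mu, checkMap, Pi.sub_apply, Pi.one_apply, Matrix.cons_val_zero, Matrix.cons_val_one]
  field_simp
  ring

lemma mem_cube_iff {x : Fin 2 → ℝ} :
    x ∈ Set.Icc 0 1 ↔ (0 ≤ x 0 ∧ x 0 ≤ 1) ∧ 0 ≤ x 1 ∧ x 1 ≤ 1 := by
  simp only [Set.mem_Icc, Pi.le_def, Fin.forall_fin_two, Pi.zero_apply, Pi.one_apply]
  tauto

lemma Lam_nonneg (β x : ℝ) : 0 ≤ Lam β x := (Real.exp_pos _).le

lemma Lam_mono (hβ : 0 ≤ β) : Monotone (Lam β) := fun x y h =>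
  Real.exp_le_exp.2 (by nlinarith)

lemma Lam_le_one (hβ : 0 ≤ β) {x : ℝ} (hx : x ≤ 1) : Lam β x ≤ 1 := by
  simpa [Lam] using Lam_mono hβ hx

@[fun_prop]
lemma continuous_Lam (β : ℝ) : Continuous (Lam β) := by
  unfold Lam
  fun_prop

lemma isCubeMap_bitMap (dl : ℕ) (hβ : 0 ≤ β) : IsCubeMap (bitMap dl β) where
  mono := by
    intro x hx y hy h
    have h0 := h 0
    have h1 := Lam_mono hβ (h 1)
    have l := Lam_nonneg β (x 1)
    obtain ⟨⟨a, -⟩, -⟩ := mem_cube_iff.1 hx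
    obtain ⟨⟨b, -⟩, -⟩ := mem_cube_iff.1 hy
    refine Fin.forall_fin_two.2 ⟨?_, ?_⟩ <;> simp only [bitMap, Matrix.cons_val_zero,
      Matrix.cons_val_one] <;> gcongr
  maps := by
    intro x hx
    obtain ⟨⟨a, b⟩, c, d⟩ := mem_cube_iff.1 hx
    have h1 := Lam_le_one hβ d
    have l := Lam_nonneg β (x 1)
    refine mem_cube_iff.2 ⟨⟨?_, ?_⟩, ?_, ?_⟩ <;> simp only [bitMap, Matrix.cons_val_zero,
      Matrix.cons_val_one]
    · positivity
    · exact mul_le_one₀ (pow_le_one₀ a b) l h1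
    · positivity
    · exact mul_le_one₀ (pow_le_one₀ a b) l h1
  cont := by
    refine continuous_pi (Fin.forall_fin_two.2 ⟨?_, ?_⟩) <;> simp only [bitMap,
      Matrix.cons_val_zero, Matrix.cons_val_one] <;> fun_prop

lemma checkMap_mono {x x' : Fin 2 → ℝ} (hx' : x' ∈ Set.Icc 0 1) (h : x ≤ x')
    {e : ℝ} (he : e ≤ ε) (hε : ε ≤ 1) : checkMap dr dg e x ≤ checkMap dr dg ε x' := by
  have h0 := h 0
  have h1 := h 1
  obtain ⟨⟨-, a⟩, -, b⟩ := mem_cube_iff.1 hx'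
  have a' := sub_nonneg.2 a
  have b' := sub_nonneg.2 b
  have hε' := sub_nonneg.2 hε
  have he' := sub_nonneg.2 (he.trans hε)
  refine Fin.forall_fin_two.2 ⟨?_, ?_⟩ <;> simp only [checkMap, Matrix.cons_val_zero,
      Matrix.cons_val_one] <;> gcongr

lemma checkMap_maps (hε : ε ∈ Set.Icc 0 1) :
    Set.MapsTo (checkMap dr dg ε) (Set.Icc 0 1) (Set.Icc 0 1) := by
  intro x hx
  obtain ⟨⟨a, b⟩, c, d⟩ := mem_cube_iff.1 hx
  have u0 : (1 - x 0) ^ (dr - 1) ≤ 1 := pow_le_one₀ (by linarith) (by linarith)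
  have u1 : (1 - x 1) ^ (dg - 1) ≤ 1 := pow_le_one₀ (by linarith) (by linarith)
  have v0 : 0 ≤ (1 - x 0) ^ (dr - 1) := pow_nonneg (by linarith) _
  have v1 : 0 ≤ (1 - x 1) ^ (dg - 1) := pow_nonneg (by linarith) _
  have e0 : 0 ≤ 1 - ε := by linarith [hε.2]
  have e1 : (1 - ε) * (1 - x 1) ^ (dg - 1) ≤ 1 := mul_le_one₀ (by linarith [hε.1]) v1 u1
  have e2 := mul_nonneg e0 v1
  refine mem_cube_iff.2 ⟨⟨?_, ?_⟩, ?_, ?_⟩ <;> simp only [checkMap, Matrix.cons_val_zero,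
      Matrix.cons_val_one] <;> linarith

lemma isCubeMap_checkMap (dr dg : ℕ) (hε : ε ∈ Set.Icc 0 1) : IsCubeMap (checkMap dr dg ε) where
  mono := fun _ _ _ hx' h => checkMap_mono hx' h le_rfl hε.2
  maps := checkMap_maps hε
  cont := by
    refine continuous_pi (Fin.forall_fin_two.2 ⟨?_, ?_⟩) <;> simp only [checkMap,
      Matrix.cons_val_zero, Matrix.cons_val_one] <;> fun_prop

/-- Convexity of `x ↦ x ^ n`, as a tangent-line bound. -/
lemma mul_pow_mul_sub_le {a b : ℝ} (ha : 0 ≤ a) (hab : a ≤ b) (n : ℕ) :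
    n * a ^ (n - 1) * (b - a) ≤ b ^ n - a ^ n := by
  induction n with
  | zero => simp
  | succ n ih =>
    have h1 : a ^ n ≤ b ^ n := by gcongr
    have h2 : (n : ℝ) * a ^ n = a * (n * a ^ (n - 1)) := by
      cases n with
      | zero => simp
      | succ n => simp only [Nat.add_sub_cancel]; ring
    have h3 := mul_le_mul_of_nonneg_left ih ha
    have h4 := mul_le_mul_of_nonneg_right h1 (sub_nonneg.2 hab)
    simp only [Nat.add_sub_cancel, Nat.cast_add, Nat.cast_one]
    calc _ = a * (n * a ^ (n - 1) * (b - a)) + a ^ n * (b - a) := by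
          rw [add_mul, h2]
          ring
      _ ≤ a * (b ^ n - a ^ n) + b ^ n * (b - a) := add_le_add h3 h4
      _ = _ := by ring

/-- Second-order bound for `x ↦ x ^ n` on `[0, 1]`. -/
lemma pow_sub_pow_sub_le {u v : ℝ} (hu : 0 ≤ u) (huv : u ≤ v) (hv : v ≤ 1) (n : ℕ) :
    v ^ n - u ^ n - n * u ^ (n - 1) * (v - u) ≤ n ^ 2 * (v - u) ^ 2 := by
  induction n with
  | zero => simp
  | succ n ih =>
    have key : v ^ (n + 1) - u ^ (n + 1) - (n + 1) * u ^ n * (v - u) =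
        v * (v ^ n - u ^ n - n * u ^ (n - 1) * (v - u)) + n * u ^ (n - 1) * (v - u) ^ 2 := by
      cases n with
      | zero => simp
      | succ n => simp only [Nat.add_sub_cancel]; push_cast; ring
    have h1 : u ^ (n - 1) ≤ 1 := pow_le_one₀ hu (huv.trans hv)
    have hs := sq_nonneg (v - u)
    have h2 : n * u ^ (n - 1) * (v - u) ^ 2 ≤ n * 1 * (v - u) ^ 2 := by gcongr
    have h3 : v * (v ^ n - u ^ n - n * u ^ (n - 1) * (v - u)) ≤ n ^ 2 * (v - u) ^ 2 := by
      refine (mul_le_mul_of_nonneg_left ih (hu.trans huv)).trans ?_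
      exact mul_le_of_le_one_left (by positivity) hv
    have h4 : (0 : ℝ) ≤ n * (v - u) ^ 2 := by positivity
    simp only [Nat.add_sub_cancel, Nat.cast_add, Nat.cast_one]
    rw [key]
    nlinarith

/-- Convexity of `ν` along increasing segments of the cube, where it is a product of two convex
increasing functions. -/
lemma sum_bitMap_le (hβ : 0 < β) {z z' : Fin 2 → ℝ} (hz : z ∈ Set.Icc 0 1) (h : z ≤ z') :
    ∑ j, edgeWeight dl dg β j * (bitMap dl β z j * (z' j - z j)) ≤
      nu dl dg β z' 0 - nu dl dg β z 0 := by
  obtain ⟨⟨a, -⟩, -⟩ := mem_cube_iff.1 hz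
  have h0 := mul_pow_mul_sub_le a (h 0) dl
  have h1 : Lam β (z 1) * (1 + β * (z' 1 - z 1)) ≤ Lam β (z' 1) := by
    have : Lam β (z' 1) = Lam β (z 1) * Real.exp (β * (z' 1 - z 1)) := by
      rw [Lam, Lam, ← Real.exp_add]
      congr 1
      ring
    rw [this]
    exact mul_le_mul_of_nonneg_left (by linarith [Real.add_one_le_exp (β * (z' 1 - z 1))])
      (Lam_nonneg _ _)
  have hl := Lam_nonneg β (z 1)
  have d0 := sub_nonneg.2 (h 0)
  have d1 := mul_nonneg hβ.le (sub_nonneg.2 (h 1))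
  have hp : 0 ≤ (dl : ℝ) * z 0 ^ (dl - 1) * (z' 0 - z 0) := by positivity
  have hprod : (z 0 ^ dl + dl * z 0 ^ (dl - 1) * (z' 0 - z 0)) *
      (Lam β (z 1) * (1 + β * (z' 1 - z 1))) ≤ z' 0 ^ dl * Lam β (z' 1) :=
    mul_le_mul (by linarith) h1 (by positivity) (pow_nonneg (a.trans (h 0)) _)
  have hcross : 0 ≤ dl * z 0 ^ (dl - 1) * (z' 0 - z 0) * (Lam β (z 1) * (β * (z' 1 - z 1))) := by
    positivity
  have hc : (0 : ℝ) ≤ dg / β := by positivity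
  calc _ = dg / β * (dl * z 0 ^ (dl - 1) * (z' 0 - z 0) * Lam β (z 1)
        + z 0 ^ dl * (Lam β (z 1) * (β * (z' 1 - z 1)))) := by
        simp only [Fin.sum_univ_two, edgeWeight, bitMap, Matrix.cons_val_zero,
          Matrix.cons_val_one]
        field_simp
    _ ≤ dg / β * (z' 0 ^ dl * Lam β (z' 1) - z 0 ^ dl * Lam β (z 1)) := by
        gcongr
        linarith
    _ = _ := by simp only [nu]; ring

/-- Second-order Taylor bound for the primitive of the check-side map. -/
lemma sum_checkMap_le (hdr : dr ≠ 0) (hβ : 0 < β) (hε : ε ∈ Set.Icc 0 1) {x x' : Fin 2 → ℝ}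
    (hx : x ∈ Set.Icc 0 1) (hx' : x' ∈ Set.Icc 0 1) (h : x ≤ x') :
    ∑ j, edgeWeight dl dg β j * ((x' j - x j) * checkMap dr dg ε x' j) ≤
      checkPrimitive dl dr dg β ε x' - checkPrimitive dl dr dg β ε x +
        (dg * dl / β * dr + dg ^ 2) * ∑ j, (x' j - x j) ^ 2 := by
  obtain ⟨⟨a, b⟩, c, d⟩ := mem_cube_iff.1 hx
  obtain ⟨⟨a', b'⟩, c', d'⟩ := mem_cube_iff.1 hx'
  have h0 := pow_sub_pow_sub_le (sub_nonneg.2 b') (sub_le_sub_left (h 0) 1) (by linarith) dr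
  have h1 := pow_sub_pow_sub_le (sub_nonneg.2 d') (sub_le_sub_left (h 1) 1) (by linarith) dg
  rw [sub_sub_sub_cancel_left] at h0 h1
  have hr : (0 : ℝ) < dr := by positivity
  have hD : (0 : ℝ) ≤ dg * dl / β := by positivity
  have k0 : dg * dl / β * (((1 - x 0) ^ dr - (1 - x' 0) ^ dr) / dr
      - (1 - x' 0) ^ (dr - 1) * (x' 0 - x 0)) ≤ dg * dl / β * (dr * (x' 0 - x 0) ^ 2) := by
    refine mul_le_mul_of_nonneg_left ?_ hD
    refine le_of_mul_le_mul_left (le_of_eq_of_le ?_ (h0.trans_eq ?_)) hr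
    · field_simp
    · ring
  have k1 : (1 - ε) * ((1 - x 1) ^ dg - (1 - x' 1) ^ dg -
      dg * (1 - x' 1) ^ (dg - 1) * (x' 1 - x 1)) ≤ dg ^ 2 * (x' 1 - x 1) ^ 2 :=
    (mul_le_mul_of_nonneg_left h1 (sub_nonneg.2 hε.2)).trans
      (mul_le_of_le_one_left (by positivity) (by linarith [hε.1]))
  have m0 : (0 : ℝ) ≤ dg ^ 2 * (x' 0 - x 0) ^ 2 := by positivity
  have m1 : (0 : ℝ) ≤ dg * dl / β * dr * (x' 1 - x 1) ^ 2 := by positivity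
  simp only [Fin.sum_univ_two, edgeWeight, checkMap, checkPrimitive, Matrix.cons_val_zero,
    Matrix.cons_val_one]
  linear_combination k0 + k1 + m0 + m1

/-- Threshold saturation for the coupled code: a uniform positive lower bound on the potential at
the nonzero fixed points makes coupled density evolution converge for all large widths. -/
lemma exists_coupledDEConverges (hdl : dl ≠ 0) (hdr : dr ≠ 0) (hdg : dg ≠ 0) (hβ : 0 < β)
    (hε : ε ∈ Set.Icc 0 1) {m : ℝ} (hm : 0 < m)
    (hpot : ∀ x ∈ fixedPoints (nu dl dg β) (mu dl dr dg β) ε,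
      m ≤ potential (nu dl dg β) (mu dl dr dg β) x ε) :
    ∃ w₀ : ℕ, ∀ w : ℕ, w₀ ≤ w → ∀ L : ℕ,
      CoupledDEConverges (nu dl dg β) (mu dl dr dg β) w L ε := by
  set K : ℝ := dg * dl / β * dr + dg ^ 2 with hK
  have hK0 : 0 ≤ K := by positivity
  obtain ⟨w₀, hw₀⟩ := exists_nat_gt (K * (2 : ℕ) / m)
  have hf := isCubeMap_bitMap dl hβ.le
  have hg := isCubeMap_checkMap dr dg hε
  refine ⟨w₀ + 1, fun w hw L e he i => ?_⟩
  have hwpos : (0 : ℝ) < w := by exact_mod_cast (by omega : 0 < w)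
  have hone := tendsto_oneSidedDE_zero (w := w) hf hg (D := edgeWeight dl dg β)
    (F := fun z => nu dl dg β z 0) (G := checkPrimitive dl dr dg β ε) (K := K)
    (Fin.forall_fin_two.2 ⟨by simp only [edgeWeight, Matrix.cons_val_zero]; positivity,
      by simp [edgeWeight]⟩) hK0
    (by unfold nu; fun_prop) (by unfold checkPrimitive; fun_prop)
    (fun z hz => by
      have := (mem_cube_iff.1 hz).1.1
      have := Lam_nonneg β (z 1)
      unfold nu
      positivity)
    (by simp [checkPrimitive])
    (fun z hz z' _ h => sum_bitMap_le hβ hz h)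
    (fun x hx x' hx' h => sum_checkMap_le hdr hβ hε hx hx' h) (by omega)
    (fun q hq hq0 hfix => by
      rw [← potential_eq hdl hdr hdg hβ.ne']
      refine lt_of_lt_of_le ?_ (hpot q ⟨fun j => ⟨hq.1 j, hq.2 j⟩, hq0, ?_⟩)
      · rw [div_lt_iff₀ hm] at hw₀
        rw [div_lt_iff₀ hwpos]
        have : (w₀ : ℝ) ≤ w := by exact_mod_cast (by omega : w₀ ≤ w)
        nlinarith
      · rw [deF_nu hdl hdg hβ.ne', deG_mu hdl hdr hdg hβ.ne', hfix]) i
  have hcmp (t : ℕ) := coupledDE_le_oneSidedDE hf hg (ν := nu dl dg β) (μ := mu dl dr dg β)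
    (fun y e => deF_nu hdl hdg hβ.ne' y e)
    (fun x hx e he => by
      rw [deG_mu hdl hdr hdg hβ.ne']
      exact ⟨(checkMap_maps ⟨he.1, he.2.trans hε.2⟩ hx).1, checkMap_mono hx le_rfl he.2 hε.2⟩)
    w L he t i
  exact tendsto_pi_nhds.2 fun j => squeeze_zero (fun t => (hcmp t).1 j) (fun t => (hcmp t).2 j)
    (tendsto_pi_nhds.1 hone j)

/-! ### The potential threshold and the rate -/

lemma one_mem_fixedPoints (hdl : dl ≠ 0) (hdr : 2 ≤ dr) (hdg : 2 ≤ dg) (hβ : β ≠ 0) :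
    1 ∈ fixedPoints (nu dl dg β) (mu dl dr dg β) ε := by
  refine ⟨by simp, one_ne_zero, ?_⟩
  rw [deF_nu hdl (by omega) hβ, deG_mu hdl (by omega) (by omega) hβ]
  have h1 : dr - 1 ≠ 0 := by omega
  have h2 : dg - 1 ≠ 0 := by omega
  funext j
  fin_cases j <;> simp [bitMap, checkMap, Lam, h1, h2]

lemma potential_one (hdl : dl ≠ 0) (hdr : 2 ≤ dr) (hdg : 2 ≤ dg) (hβ : β ≠ 0) :
    potential (nu dl dg β) (mu dl dr dg β) 1 ε = shannonLimit dl dr dg β - ε := by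
  rw [potential_eq hdl (by omega) (by omega) hβ]
  have h1 : dr - 1 ≠ 0 := by omega
  have h2 : dg - 1 ≠ 0 := by omega
  have h3 : dr ≠ 0 := by omega
  have h4 : dg ≠ 0 := by omega
  simp [edgeWeight, checkMap, checkPrimitive, nu, Lam, shannonLimit, totalRate, preRate, h1, h2,
    h3, h4]
  field_simp
  ring

/-- If the nonzero fixed points stay away from the face `x₁ = 0` and have positive potential, then
by compactness the potential has a positive lower bound on them. -/
lemma exists_potential_lower_bound (hdl : dl ≠ 0) (hdr : 2 ≤ dr) (hdg : 2 ≤ dg) (hβ : 0 < β)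
    (hε : ε ∈ Set.Icc 0 1) {δ : ℝ} (hδ : 0 < δ)
    (hpos : ∀ x ∈ fixedPoints (nu dl dg β) (mu dl dr dg β) ε,
      δ ≤ x 0 ∧ 0 < potential (nu dl dg β) (mu dl dr dg β) x ε) :
    ∃ m > 0, ∀ x ∈ fixedPoints (nu dl dg β) (mu dl dr dg β) ε,
      m ≤ potential (nu dl dg β) (mu dl dr dg β) x ε := by
  have hf := (isCubeMap_bitMap dl hβ.le).cont
  have hg := (isCubeMap_checkMap dr dg hε).cont
  have hset : fixedPoints (nu dl dg β) (mu dl dr dg β) ε =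
      Set.Icc 0 1 ∩ ({x | δ ≤ x 0} ∩ {x | bitMap dl β (checkMap dr dg ε x) = x}) := by
    ext x
    constructor
    · intro hx
      refine ⟨⟨fun j => (hx.1 j).1, fun j => (hx.1 j).2⟩, (hpos x hx).1, ?_⟩
      have := hx.2.2
      rwa [deF_nu hdl (by omega) hβ.ne', deG_mu hdl (by omega) (by omega) hβ.ne'] at this
    · rintro ⟨hx, h0, hfix⟩
      refine ⟨fun j => ⟨hx.1 j, hx.2 j⟩, ?_, ?_⟩
      · rintro rfl
        exact absurd hδ (not_lt.2 h0)
      · rw [deF_nu hdl (by omega) hβ.ne', deG_mu hdl (by omega) (by omega) hβ.ne']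
        exact hfix
  have hcomp : IsCompact (fixedPoints (nu dl dg β) (mu dl dr dg β) ε) := by
    rw [hset]
    exact isCompact_Icc.inter_right ((isClosed_le continuous_const (continuous_apply 0)).inter
      (isClosed_eq (hf.comp hg) continuous_id))
  have hcont : Continuous fun x => potential (nu dl dg β) (mu dl dr dg β) x ε := by
    simp only [potential_eq hdl (by omega : dr ≠ 0) (by omega : dg ≠ 0) hβ.ne']
    unfold nu checkPrimitive
    fun_prop
  obtain ⟨x, hx, hmin⟩ := hcomp.exists_isMinOn ⟨1, one_mem_fixedPoints hdl hdr hdg hβ.ne'⟩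
    hcont.continuousOn
  exact ⟨_, (hpos x hx).2, fun y hy => hmin hy⟩

/-- The potential threshold is the Shannon limit as soon as every `ε` below the Shannon limit has a
positive energy gap: at the fixed point `1` the potential equals the Shannon limit minus `ε`. -/
lemma positiveGapSet_eq (hdl : dl ≠ 0) (hdr : 2 ≤ dr) (hdg : 2 ≤ dg) (hβ : 0 < β)
    (hs : shannonLimit dl dr dg β ≤ 1)
    (hgap : ∀ ε, 0 ≤ ε → ε < shannonLimit dl dr dg β →
      ∃ m > 0, ∀ x ∈ fixedPoints (nu dl dg β) (mu dl dr dg β) ε,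
        m ≤ potential (nu dl dg β) (mu dl dr dg β) x ε) :
    positiveGapSet (nu dl dg β) (mu dl dr dg β) = Set.Ico 0 (shannonLimit dl dr dg β) := by
  ext ε
  have hone : 1 ∈ fixedPoints (nu dl dg β) (mu dl dr dg β) ε :=
    one_mem_fixedPoints hdl hdr hdg hβ.ne'
  constructor
  · rintro ⟨⟨h0, -⟩, hpos⟩
    refine ⟨h0, ?_⟩
    -- the junk value `sInf = 0` on sets that are unbounded below is excluded by positivity
    have hbdd : BddBelow ((fun x => potential (nu dl dg β) (mu dl dr dg β) x ε) ''
        fixedPoints (nu dl dg β) (mu dl dr dg β) ε) := by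
      by_contra h
      rw [Real.sInf_of_not_bddBelow h] at hpos
      exact hpos.false
    have : 0 < potential (nu dl dg β) (mu dl dr dg β) 1 ε :=
      hpos.trans_le (csInf_le hbdd ⟨1, hone, rfl⟩)
    rw [potential_one hdl hdr hdg hβ.ne'] at this
    linarith
  · rintro ⟨h0, h1⟩
    obtain ⟨m, hm, hle⟩ := hgap ε h0 h1
    refine ⟨⟨h0, h1.le.trans hs⟩, hm.trans_le (le_csInf ⟨_, 1, hone, rfl⟩ ?_)⟩
    rintro _ ⟨x, hx, rfl⟩
    exact hle x hx

lemma tendsto_coupledRate (dl dr dg : ℕ) (β : ℝ) (w : ℕ) :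
    Tendsto (fun L : ℕ => coupledRate dl dr dg β w L) atTop (𝓝 (totalRate dl dr dg β)) := by
  have hinv : Tendsto (fun L : ℕ => ((L : ℝ) + (w - 1))⁻¹) atTop (𝓝 0) :=
    (tendsto_atTop_add_const_right _ _ tendsto_natCast_atTop_atTop).inv_tendsto_atTop
  have h : Tendsto (fun L : ℕ => (dg : ℝ) / β *
      (1 - ((w : ℝ) - 1) * ((L : ℝ) + (w - 1))⁻¹ - dl / dr)) atTop
      (𝓝 (dg / β * (1 - ((w : ℝ) - 1) * 0 - dl / dr))) :=
    (((hinv.const_mul _).const_sub _).sub_const _).const_mul _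
  rw [mul_zero, sub_zero] at h
  refine h.congr' ?_
  filter_upwards [eventually_gt_atTop 1] with L hL
  have h1 : (1 : ℝ) < L := by exact_mod_cast hL
  have hpos : (L : ℝ) + (w - 1) ≠ 0 := by
    have : (0 : ℝ) ≤ w := w.cast_nonneg
    linarith
  rw [coupledRate, add_sub_assoc, mul_comm ((β : ℝ) / dg), ← div_div, div_div_eq_mul_div,
    mul_comm, div_eq_mul_inv, mul_comm]
  field_simp
  ring

/-! ### Positivity of the potential for the two codes -/

/-- Positivity of the potential at the fixed points of the `(2, 3, 3)` code, multiplied by `β`, with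
`c = β (1 - ε)`, `x = x₁`, `z = x₂` and `E` the value of `Λ`. -/
lemma potential_pos_two_three {x z c E : ℝ} (hx : 0 < x) (hx1 : x ≤ 1) (hz : z ≤ 1) (hc : 1 < c)
    (hE : E = Real.exp (-(c * (1 - z) ^ 2))) (h1 : (1 - (1 - x) ^ 2) * E = x)
    (h2 : (1 - (1 - x) ^ 2) ^ 2 * E = z) :
    1 / 5 ≤ x ∧ 0 < 2 * (1 - (1 - x) ^ 3) + c * (1 - (1 - z) ^ 3) - 3 * z
      - 6 * (x * (1 - x) ^ 2) - 3 * c * (z * (1 - z) ^ 2) := by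
  have hzx : z = x ^ 2 * (2 - x) := by
    rw [← h2]
    linear_combination (1 - (1 - x) ^ 2) * h1
  have hE1 : (2 - x) * E = 1 := by
    refine mul_left_cancel₀ hx.ne' ?_
    linear_combination h1
  have hlow : 1 / 5 ≤ x := by
    by_contra! hlt
    have hz2 : z ≤ 2 / 25 := by rw [hzx]; nlinarith
    have hs : 4 / 5 ≤ c * (1 - z) ^ 2 := by nlinarith
    have hexp : 2 < Real.exp (c * (1 - z) ^ 2) := by
      have := Real.quadratic_le_exp_of_nonneg (x := c * (1 - z) ^ 2) (by linarith)
      nlinarith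
    have : E * Real.exp (c * (1 - z) ^ 2) = 1 := by
      rw [hE, ← Real.exp_add]
      simp
    have hE0 : 0 < E := by rw [hE]; exact Real.exp_pos _
    nlinarith
  refine ⟨hlow, ?_⟩
  have hz0 : 0 < z := by rw [hzx]; exact mul_pos (by positivity) (by linarith)
  have hB : 0 < z ^ 2 * (3 - 2 * z) := mul_pos (by positivity) (by linarith)
  have hpoly : x ^ 3 ≤ z ^ 2 * (3 - 2 * z) := by
    have key : 1 ≤ x * (2 - x) ^ 2 * (3 - 2 * (x ^ 2 * (2 - x))) := by
      -- in terms of `s = 1 - x` the difference is `s (3 + 3 s - 3 s² - 6 s³ + 2 s⁵)`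
      have hs : 0 ≤ 1 - x := by linarith
      have hs2 : (1 - x) ^ 2 ≤ 16 / 25 := by nlinarith
      have hs3 : (1 - x) ^ 3 ≤ 16 / 25 * (1 - x) := by
        rw [pow_succ]
        exact mul_le_mul_of_nonneg_right hs2 hs
      have hs5 : 0 ≤ (1 - x) ^ 5 := by positivity
      have := mul_nonneg hs (by linarith : 0 ≤ 3 + 3 * (1 - x) - 3 * (1 - x) ^ 2
        - 6 * (1 - x) ^ 3 + 2 * (1 - x) ^ 5)
      linarith
    have := mul_le_mul_of_nonneg_left key (by positivity : 0 ≤ x ^ 3)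
    rw [hzx]
    linarith
  have := mul_lt_mul_of_pos_right hc hB
  have e : 2 * (1 - (1 - x) ^ 3) + c * (1 - (1 - z) ^ 3) - 3 * z - 6 * (x * (1 - x) ^ 2)
      - 3 * c * (z * (1 - z) ^ 2) = -x ^ 3 + c * (z ^ 2 * (3 - 2 * z)) := by
    linear_combination (-3) * hzx
  rw [e]
  linarith

/-- Positivity of the potential at the fixed points of the `(3, 4, 3)` code, in the same
notation. -/
lemma potential_pos_three_four {x z c E : ℝ} (hx : 0 < x) (hx1 : x ≤ 1) (hz : z ≤ 1)
    (hc : 3 / 4 < c) (hE : E = Real.exp (-(c * (1 - z) ^ 2)))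
    (h1 : (1 - (1 - x) ^ 3) ^ 2 * E = x) (h2 : (1 - (1 - x) ^ 3) ^ 3 * E = z) :
    1 / 9 ≤ x ∧ 0 < 9 / 4 * (1 - (1 - x) ^ 4) + c * (1 - (1 - z) ^ 3) - 3 * z
      - 9 * (x * (1 - x) ^ 3) - 3 * c * (z * (1 - z) ^ 2) := by
  have hzx : z = x ^ 2 * (3 - 3 * x + x ^ 2) := by
    rw [← h2]
    linear_combination (1 - (1 - x) ^ 3) * h1
  have hE1 : E ≤ 1 := by
    rw [hE, Real.exp_le_one_iff]
    have : 0 ≤ c * (1 - z) ^ 2 := mul_nonneg (by linarith) (sq_nonneg _)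
    linarith
  have hq : 0 < 3 - 3 * x + x ^ 2 := by nlinarith
  refine ⟨?_, ?_⟩
  · have h3 : x * (3 - 3 * x + x ^ 2) ^ 2 * E = 1 := by
      refine mul_left_cancel₀ hx.ne' ?_
      linear_combination h1
    have h4 : (3 - 3 * x + x ^ 2) ^ 2 ≤ 3 ^ 2 := by gcongr; nlinarith
    have hE0 : 0 ≤ E := by rw [hE]; positivity
    have h5 : x * (3 - 3 * x + x ^ 2) ^ 2 * E ≤ x * 3 ^ 2 * 1 := by gcongr
    linarith
  have hz0 : 0 < z := by rw [hzx]; positivity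
  have hB : 0 < z ^ 2 * (3 - 2 * z) := mul_pos (by positivity) (by linarith)
  have hpoly : 0 ≤ 9 / 2 * x ^ 2 - 9 * x ^ 3 + 15 / 4 * x ^ 4
      + 3 / 4 * (z ^ 2 * (3 - 2 * z)) := by
    have key : 0 ≤ 6 - 12 * x + 5 * x ^ 2 +
        x ^ 2 * (3 - 3 * x + x ^ 2) ^ 2 * (3 - 2 * (x ^ 2 * (3 - 3 * x + x ^ 2))) := by
      -- in terms of `u = 1 - x` the right side is at least `4 u + 5 u² - 2 u³ - 4 u⁴`
      have hu : 0 ≤ 1 - x := by linarith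
      have hu1 : 1 - x ≤ 1 := by linarith
      have p2 : 0 ≤ (1 - x) ^ 2 * (1 - (1 - x)) :=
        mul_nonneg (by positivity) (by linarith)
      have p3 : (1 - x) ^ 3 ≤ 1 := pow_le_one₀ hu hu1
      have p4 : 0 ≤ (1 - x) * (1 - (1 - x) ^ 3) := mul_nonneg hu (by linarith)
      have p5 : 0 ≤ (1 - x) ^ 3 * (1 - (1 - x)) := mul_nonneg (by positivity) (by linarith)
      have p6 : 0 ≤ (1 - (1 - x) ^ 3) ^ 2 * ((1 - x) ^ 3 * (1 - (1 - x))) :=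
        mul_nonneg (sq_nonneg _) p5
      have p7 : 0 ≤ ((1 - x) ^ 3) ^ 2 * (1 + 2 * (1 - x)) := by positivity
      have p8 : 0 ≤ (1 - x) ^ 2 := by positivity
      nlinarith
    have := mul_nonneg (by positivity : 0 ≤ 3 / 4 * x ^ 2) key
    rw [hzx]
    linarith
  have := mul_lt_mul_of_pos_right hc hB
  have e : 9 / 4 * (1 - (1 - x) ^ 4) + c * (1 - (1 - z) ^ 3) - 3 * z - 9 * (x * (1 - x) ^ 3)
      - 3 * c * (z * (1 - z) ^ 2) = 9 / 2 * x ^ 2 - 9 * x ^ 3 + 15 / 4 * x ^ 4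
      + c * (z ^ 2 * (3 - 2 * z)) := by
    linear_combination (-3) * hzx
  rw [e]
  linarith

/-- Below the Shannon limit, the nonzero fixed points of both codes stay away from the face
`x₁ = 0` and have positive potential. -/
lemma fixedPoints_potential_pos
    (hd : (dl = 2 ∧ dr = 3 ∧ dg = 3) ∨ (dl = 3 ∧ dr = 4 ∧ dg = 3)) (hβ : 0 < β)
    (hc : dg * preRate dl dr < β * (1 - ε)) :
    ∃ δ > 0, ∀ x ∈ fixedPoints (nu dl dg β) (mu dl dr dg β) ε,
      δ ≤ x 0 ∧ 0 < potential (nu dl dg β) (mu dl dr dg β) x ε := by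
  refine ⟨1 / 9, by norm_num, fun x hx => ?_⟩
  obtain ⟨hcube, hne, hfix⟩ := hx
  have hdl : dl ≠ 0 := by omega
  have hdr : dr ≠ 0 := by omega
  have hdg : dg ≠ 0 := by omega
  rw [deF_nu hdl hdg hβ.ne', deG_mu hdl hdr hdg hβ.ne'] at hfix
  rw [potential_eq hdl hdr hdg hβ.ne', ← mul_pos_iff_of_pos_left hβ]
  have h0 := congrFun hfix 0
  have h1 := congrFun hfix 1
  have hx0 : 0 < x 0 := by
    refine (hcube 0).1.lt_of_ne' fun h => hne ?_
    have : x 1 = 0 := by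
      rw [← h1]
      rcases hd with ⟨rfl, rfl, rfl⟩ | ⟨rfl, rfl, rfl⟩ <;> simp [bitMap, checkMap, h]
    funext j
    fin_cases j
    · exact h
    · exact this
  have hL (n : ℕ) : Lam β (1 - (1 - ε) * (1 - x 1) ^ n) =
      Real.exp (-(β * (1 - ε) * (1 - x 1) ^ n)) := by
    rw [Lam]
    congr 1
    ring
  simp only [bitMap, checkMap, Matrix.cons_val_zero, Matrix.cons_val_one, hL] at h0 h1
  simp only [Fin.sum_univ_two, edgeWeight, checkPrimitive, nu, checkMap, Matrix.cons_val_zero,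
    Matrix.cons_val_one, hL]
  rcases hd with ⟨rfl, rfl, rfl⟩ | ⟨rfl, rfl, rfl⟩
  · norm_num [preRate] at hc h0 h1 ⊢
    obtain ⟨k1, k2⟩ := potential_pos_two_three hx0 (hcube 0).2 (hcube 1).2 hc rfl h0 h1
    refine ⟨by linarith, k2.trans_eq ?_⟩
    field_simp
    linear_combination 9 * h1
  · norm_num [preRate] at hc h0 h1 ⊢
    obtain ⟨k1, k2⟩ := potential_pos_three_four hx0 (hcube 0).2 (hcube 1).2 (by linarith) rfl h0 h1
    refine ⟨by linarith, k2.trans_eq ?_⟩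
    field_simp
    linear_combination 12 * h1

end Code

end PrecodedRateless

open PrecodedRateless

theorem mainTheorem1 (dl dr dg : ℕ)
    (hd : (dl = 2 ∧ dr = 3 ∧ dg = 3) ∨ (dl = 3 ∧ dr = 4 ∧ dg = 3)) :
    (∀ β : ℝ, (dg : ℝ) * PrecodedRateless.preRate dl dr < β →
      -- the potential threshold is well defined and equals the Shannon limit
      (PrecodedRateless.positiveGapSet (PrecodedRateless.nu dl dg β)
          (PrecodedRateless.mu dl dr dg β)).Nonempty ∧
      PrecodedRateless.potentialThreshold (PrecodedRateless.nu dl dg β)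
          (PrecodedRateless.mu dl dr dg β) = PrecodedRateless.shannonLimit dl dr dg β ∧
      -- below the Shannon limit, coupled density evolution converges to zero
      (∀ ε : ℝ, 0 ≤ ε → ε < PrecodedRateless.shannonLimit dl dr dg β →
        ∃ w₀ : ℕ, ∀ w : ℕ, w₀ ≤ w → ∀ L : ℕ,
          PrecodedRateless.CoupledDEConverges (PrecodedRateless.nu dl dg β)
            (PrecodedRateless.mu dl dr dg β) w L ε) ∧
      -- the rate loss of coupling vanishes
      (∀ w : ℕ, 1 ≤ w →
        Tendsto (fun L : ℕ => PrecodedRateless.coupledRate dl dr dg β w L) atTop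
          (𝓝 (PrecodedRateless.totalRate dl dr dg β)))) ∧
    -- every rate below the capacity `1 - ε` is achieved
    (∀ ε : ℝ, 0 ≤ ε → ε < 1 → ∀ R : ℝ, R < 1 - ε →
      ∃ β : ℝ, (dg : ℝ) * PrecodedRateless.preRate dl dr < β ∧
        ∃ w₀ : ℕ, ∀ w : ℕ, w₀ ≤ w → ∃ L₀ : ℕ, ∀ L : ℕ, L₀ ≤ L →
          R < PrecodedRateless.coupledRate dl dr dg β w L ∧
          PrecodedRateless.CoupledDEConverges (PrecodedRateless.nu dl dg β)
            (PrecodedRateless.mu dl dr dg β) w L ε) := by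
  have hdl : dl ≠ 0 := by omega
  have hdr : 2 ≤ dr := by omega
  have hdg : 2 ≤ dg := by omega
  have hrate : 0 < (dg : ℝ) * preRate dl dr := by
    rcases hd with ⟨rfl, rfl, rfl⟩ | ⟨rfl, rfl, rfl⟩ <;> norm_num [preRate]
  have hgap (β : ℝ) (hβ : (dg : ℝ) * preRate dl dr < β) (ε : ℝ) (h0 : 0 ≤ ε)
      (h1 : ε < shannonLimit dl dr dg β) :
      ε ∈ Set.Icc 0 1 ∧ ∃ m > 0, ∀ x ∈ fixedPoints (nu dl dg β) (mu dl dr dg β) ε,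
        m ≤ potential (nu dl dg β) (mu dl dr dg β) x ε := by
    have hβ0 := hrate.trans hβ
    have hlt : totalRate dl dr dg β < 1 - ε := by
      rw [shannonLimit] at h1
      linarith
    have hpos : 0 < totalRate dl dr dg β := by
      rw [totalRate, div_mul_eq_mul_div]
      exact div_pos hrate hβ0
    have hε : ε ∈ Set.Icc 0 1 := ⟨h0, by linarith⟩
    have hc : dg * preRate dl dr < β * (1 - ε) := by
      rw [totalRate, div_mul_eq_mul_div, div_lt_iff₀ hβ0] at hlt
      linarith
    obtain ⟨δ, hδ, h⟩ := fixedPoints_potential_pos hd hβ0 hc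
    exact ⟨hε, exists_potential_lower_bound hdl hdr hdg hβ0 hε hδ h⟩
  have hconv (β : ℝ) (hβ : (dg : ℝ) * preRate dl dr < β) (ε : ℝ) (h0 : 0 ≤ ε)
      (h1 : ε < shannonLimit dl dr dg β) :
      ∃ w₀ : ℕ, ∀ w : ℕ, w₀ ≤ w → ∀ L : ℕ,
        CoupledDEConverges (nu dl dg β) (mu dl dr dg β) w L ε := by
    obtain ⟨hε, m, hm, h⟩ := hgap β hβ ε h0 h1
    exact exists_coupledDEConverges hdl (by omega) (by omega) (hrate.trans hβ) hε hm h
  refine ⟨fun β hβ => ?_, fun ε h0 h1 R hR => ?_⟩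
  · have hβ0 := hrate.trans hβ
    have hs0 : 0 < shannonLimit dl dr dg β := by
      rw [shannonLimit, totalRate, div_mul_eq_mul_div, sub_pos, div_lt_one hβ0]
      exact hβ
    have hs1 : shannonLimit dl dr dg β ≤ 1 := by
      rw [shannonLimit, totalRate, div_mul_eq_mul_div]
      linarith [div_pos hrate hβ0]
    have hset := positiveGapSet_eq hdl hdr hdg hβ0 hs1 fun ε h0 h1 => (hgap β hβ ε h0 h1).2
    refine ⟨hset ▸ Set.nonempty_Ico.2 hs0, ?_, hconv β hβ, fun w _ => tendsto_coupledRate ..⟩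
    rw [potentialThreshold, hset, csSup_Ico hs0]
  · -- choose `β` so that the total rate lies strictly between `max R 0` and `1 - ε`
    obtain ⟨ρ, hρ, hρ1⟩ := exists_between (max_lt hR (sub_pos.2 h1))
    have hρ0 : 0 < ρ := (le_max_right _ _).trans_lt hρ
    have htot : totalRate dl dr dg (dg * preRate dl dr / ρ) = ρ := by
      rw [totalRate, div_mul_eq_mul_div, div_div_cancel₀ hrate.ne']
    have hβ : (dg : ℝ) * preRate dl dr < dg * preRate dl dr / ρ := by
      rw [lt_div_iff₀ hρ0]
      exact mul_lt_of_lt_one_right hrate (by linarith)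
    refine ⟨_, hβ, ?_⟩
    obtain ⟨w₀, hw₀⟩ := hconv _ hβ ε h0 (by rw [shannonLimit, htot]; linarith)
    refine ⟨w₀, fun w hw => ?_⟩
    have hev := (tendsto_coupledRate dl dr dg (dg * preRate dl dr / ρ) w).eventually_const_lt
      (u := R) (by rw [htot]; exact (le_max_left _ _).trans_lt hρ)
    obtain ⟨L₀, hL₀⟩ := eventually_atTop.1 hev
    exact ⟨L₀, fun L hL => ⟨hL₀ L hL, hw₀ w hw L⟩⟩
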